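/- Terms are built over a signature $\mathcal F$ and a set of variables $\mathcal V$. A rewrite rule is an arbitrary pair of terms $l \to r$ (no variable conditions), and a TRS is a (possibly infinite) set of rewrite rules. For a TRS $\mathcal R$, $\mathcal R_{\mathsf d}$ is the set of its duplicating rules, i.e. the rules $l\to r$ such that some variable occurs more often in $r$ than in $l$, and $\mathcal R_{\mathsf{nd}} = \mathcal R \setminus \mathcal R_{\mathsf d}$. The relation $\to_{\mathcal R_{\mathsf d}/\mathcal R_{\mathsf{nd}}}$ is $\to_{\mathcal R_{\mathsf{nd}}}^* \cdot \to_{\mathcal R_{\mathsf d}} \cdot \to_{\mathcal R_{\mathsf{nd}}}^*$, and $\mathcal R_{\mathsf d}$ terminates relative to $\mathcal R_{\mathsf{nd}}$ if this relation has no infinite chains. A step $s \to^{\pi} t$ with redex pattern $\pi=\langle p, l\to r,\sigma\rangle$ means $l \to r \in \mathcal R$, $s|_p = l\sigma$ and $t = s[r\sigma]_p$. For relations $>$ and $\geqslant$ on a set of labels, a labeling is a function $\ell$ from rewrite steps (used forwards, $s \to^\pi t$, or backwards, $t \mathrel{{}^{\pi}{\leftarrow}} s$) to labels such that for all contexts $C$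 with hole position $q$ and all substitutions $\sigma$: $\ell(s\to^{\pi_1}t) > \ell(u\to^{\pi_2}v)$ implies $\ell(C[s\sigma]\to^{C[\pi_1\sigma]}C[t\sigma]) > \ell(C[u\sigma]\to^{C[\pi_2\sigma]}C[v\sigma])$, the same with $\geqslant$ in place of $>$, and $\ell(s\to^\pi t)=\ell(t\mathrel{{}^{\pi}{\leftarrow}}s)$; here $C[\pi\sigma]=\langle qp,l\to r,\tau\sigma\rangle$ for $\pi=\langle p,l\to r,\tau\rangle$. A local peak $t \mathrel{{}^{\pi_1}{\leftarrow}} s \to^{\pi_2} u$, with $\pi_1=\langle p,l_1\to r_1,\sigma_1\rangle$ and $\pi_2=\langle q,l_2\to r_2,\sigma_2\rangle$, is a parallel peak if neither of $p,q$ is a prefix of the other, and a variable peak if $p = qq'$ for some $q'$ that is not a function symbol position of $l_2$. With $\alpha = \ell(t \mathrel{{}^{\pi_1}{\leftarrow}} s)$ and $\beta=\ell(s\to^{\pi_2}u)$, it is extended locally decreasing (for $\ell$, $>$, $\geqslant$) if there are terms and $\mathcal R$-steps $$t \leftrightarrow^* t' \to^= t'' \leftrightarrow^* u'' \mathrel{{}^={\leftarrow}}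 u' \leftrightarrow^* u$$ such that every label $\gamma$ in the five successive parts satisfies, respectively, $\alpha>\gamma$; $\beta\geqslant\gamma$; $\alpha>\gamma$ or $\beta>\gamma$; $\alpha\geqslant\gamma$; $\beta>\gamma$. A labeling is compatible with $\mathcal R$ if all parallel peaks and all variable peaks of $\mathcal R$ are extended locally decreasing for it. The source labeling is $\ell^{\mathsf{src}}(s\to^\pi t)=\ell^{\mathsf{src}}(t\mathrel{{}^{\pi}{\leftarrow}}s)=s$; its labels (terms) are compared by ${>} = {\to_{\mathcal R_{\mathsf d}/\mathcal R_{\mathsf{nd}}}^+}$ and ${\geqslant} = {\to_{\mathcal R}^*}$. **Lemma.** Let $\mathcal R$ be a left-linear TRS (no variable occurs twice in a left-hand side) such that $\mathcal R_{\mathsf d}$ terminates relative to $\mathcal R_{\mathsf{nd}}$. Then $>$ is a well-founded order, $\geqslant$ is a preorder, and ${\geqslant}\cdot{>}\cdot{\geqslant}\subseteq{>}$. Moreover, with these relations: 1. the source labeling is a labeling; 2. parallel peaks of $\mathcal R$ are extended locally decreasing for the source labeling; 3. variable peaks of $\mathcal R$ are extended locally decreasing for the source labeling; 4. the source labeling is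 compatible with $\mathcal R$. -/

import Mathlib

/-!  Terms over a signature and a set of variables are `L.Term V`; the function symbols of arity `n`
are `L.Functions n` (the relation symbols of `L` play no role). -/

universe u v w x

namespace TermRewriting

variable {L : FirstOrder.Language.{u, v}} {V : Type w}

/-- Positions are strings of positive natural numbers; `q ≤ p` is `q <+: p`. -/
abbrev Position : Type := List ℕ+

/-- Substitutions; `tσ` is `t.subst σ`. -/
abbrev Subst (L : FirstOrder.Language.{u, v}) (V : Type w) : Type (max u w) := V → L.Term V

/-- The subterm `t|_p`, which is `none` if `p` is not a position of `t`. -/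
def subtermAt : L.Term V → Position → Option (L.Term V)
  | t, [] => some t
  | .var _, _ :: _ => none
  | @FirstOrder.Language.Term.func _ _ n _ ts, i :: p =>
      if h : i.natPred < n then subtermAt (ts ⟨i.natPred, h⟩) p else none

/-- `t[u]_p`: replace the subterm of `t` at position `p` by `u`
(nothing happens if `p` is not a position of `t`). -/
def replaceAt : L.Term V → Position → L.Term V → L.Term V
  | _, [], u => u
  | .var y, _ :: _, _ => .var y
  | .func f ts, i :: p, u =>
      .func f (fun j => if (j : ℕ) = i.natPred then replaceAt (ts j) p u else ts j)

/-- The set of function symbol positions of `t`. -/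
def FPos (t : L.Term V) : Set Position :=
  {p | ∃ (n : ℕ) (f : L.Functions n) (ts : Fin n → L.Term V),
    subtermAt t p = some (FirstOrder.Language.Term.func f ts)}

open Classical in
/-- `|t|_y`: the number of occurrences of the variable `y` in `t`. -/
noncomputable def occ (y : V) : L.Term V → ℕ
  | .var z => if z = y then 1 else 0
  | .func _ ts => ∑ j, occ y (ts j)

/-- Contexts. In `arg f i ts C` the `i`-th argument of `f` is the context `C` and the other
arguments are given by `ts` (the value `ts i` is ignored). -/
inductive Context (L : FirstOrder.Language.{u, v}) (V : Type w) : Type (max u w)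
  | hole : Context L V
  | arg {n : ℕ} (f : L.Functions n) (i : Fin n) (ts : Fin n → L.Term V) (C : Context L V) :
      Context L V

/-- `C[t]`: fill the hole of `C` with `t`. -/
def Context.fill : Context L V → L.Term V → L.Term V
  | .hole, t => t
  | .arg f i ts C, t => .func f (fun j => if j = i then C.fill t else ts j)

/-- The position of the hole of `C`. -/
def Context.holePos : Context L V → Position
  | .hole => []
  | .arg _ i _ C => Nat.succPNat i :: C.holePos

/-- Rewrite rules `lhs → rhs`; no variable conditions are imposed. -/
structure Rule (L : FirstOrder.Language.{u, v}) (V : Type w) where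
  lhs : L.Term V
  rhs : L.Term V

/-- A term rewrite system is a (possibly infinite) set of rewrite rules. -/
abbrev TRS (L : FirstOrder.Language.{u, v}) (V : Type w) : Type (max u w) := Set (Rule L V)

/-- A rule is duplicating if some variable occurs more often on the right than on the left. -/
def Rule.Duplicating (ρ : Rule L V) : Prop := ∃ y, occ y ρ.lhs < occ y ρ.rhs

/-- The duplicating rules of `R`. -/
def dup (R : TRS L V) : TRS L V := {ρ ∈ R | ρ.Duplicating}

/-- The non-duplicating rules of `R`. -/
def nondup (R : TRS L V) : TRS L V := {ρ ∈ R | ¬ ρ.Duplicating}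

/-- No variable occurs more than once in a left-hand side. -/
def LeftLinear (R : TRS L V) : Prop := ∀ ρ ∈ R, ∀ y, occ y ρ.lhs ≤ 1

/-- Redex patterns `⟨p, l → r, σ⟩`. -/
structure RedexPattern (L : FirstOrder.Language.{u, v}) (V : Type w) where
  pos : Position
  rule : Rule L V
  sub : Subst L V

/-- The step `s →^π t` of `R`. -/
def StepWith (R : TRS L V) (s : L.Term V) (π : RedexPattern L V) (t : L.Term V) : Prop :=
  π.rule ∈ R ∧ subtermAt s π.pos = some (π.rule.lhs.subst π.sub) ∧
    t = replaceAt s π.pos (π.rule.rhs.subst π.sub)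

/-- The rewrite relation `→_R`. -/
def Rew (R : TRS L V) (s t : L.Term V) : Prop := ∃ π, StepWith R s π t

/-- The relative rewrite relation `→_{R/S} = →_S^* · →_R · →_S^*`. -/
def RelRew (R S : TRS L V) : L.Term V → L.Term V → Prop :=
  Relation.Comp (Relation.ReflTransGen (Rew S))
    (Relation.Comp (Rew R) (Relation.ReflTransGen (Rew S)))

/-- A relation `>` is well-founded in the sense of rewriting: there is no infinite chain
`a₀ > a₁ > ⋯`. -/
def Terminating {A : Type x} (gt : A → A → Prop) : Prop := WellFounded (fun a b => gt b a)

/-- `R` is terminating relative to `S`. -/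
def TerminatesRelativeTo (R S : TRS L V) : Prop := Terminating (RelRew R S)

/-- A rewrite step `source →^pattern target` together with the direction in which it is used:
`forward = true` stands for `source → target` and `forward = false` for `target ← source`. -/
structure Step (L : FirstOrder.Language.{u, v}) (V : Type w) where
  source : L.Term V
  pattern : RedexPattern L V
  target : L.Term V
  forward : Bool

/-- The data of `a` form a rewrite step of `R`. -/
def Step.Valid (R : TRS L V) (a : Step L V) : Prop := StepWith R a.source a.pattern a.target

/-- `C[πσ] = ⟨qp, l → r, τσ⟩` for `π = ⟨p, l → r, τ⟩` and `q` the hole position of `C`. -/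
def RedexPattern.lift (C : Context L V) (σ : Subst L V) (π : RedexPattern L V) :
    RedexPattern L V :=
  ⟨C.holePos ++ π.pos, π.rule, fun y => (π.sub y).subst σ⟩

/-- `C[sσ] →^{C[πσ]} C[tσ]` for a step `s →^π t`, used in the same direction. -/
def Step.lift (C : Context L V) (σ : Subst L V) (a : Step L V) : Step L V :=
  ⟨C.fill (a.source.subst σ), a.pattern.lift C σ, C.fill (a.target.subst σ), a.forward⟩

section Labels

variable {Λ : Type x}

/-- `ℓ` is a labeling of the rewrite steps of `R`, for the relations `>` and `≥` on labels. -/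
structure IsLabeling (R : TRS L V) (gt ge : Λ → Λ → Prop) (lab : Step L V → Λ) : Prop where
  gt_lift : ∀ a b : Step L V, a.Valid R → b.Valid R → gt (lab a) (lab b) →
    ∀ (C : Context L V) (σ : Subst L V), gt (lab (a.lift C σ)) (lab (b.lift C σ))
  ge_lift : ∀ a b : Step L V, a.Valid R → b.Valid R → ge (lab a) (lab b) →
    ∀ (C : Context L V) (σ : Subst L V), ge (lab (a.lift C σ)) (lab (b.lift C σ))
  symm : ∀ (s : L.Term V) (π : RedexPattern L V) (t : L.Term V), StepWith R s π t →
    lab ⟨s, π, t, true⟩ = lab ⟨s, π, t, false⟩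

/-- `>` is a well-founded order, `≥` is a preorder, and they are compatible:
`≥ · > · ≥ ⊆ >`. -/
structure IsOrderPair (gt ge : Λ → Λ → Prop) : Prop where
  gt_terminating : Terminating gt
  gt_trans : ∀ a b c, gt a b → gt b c → gt a c
  ge_refl : ∀ a, ge a a
  ge_trans : ∀ a b c, ge a b → ge b c → ge a c
  compat : ∀ a b c d, ge a b → gt b c → ge c d → gt a d

/-- `Conversion R s c t`: the list `c` of steps is a conversion `s ↔_R^* t`. -/
inductive Conversion (R : TRS L V) : L.Term V → List (Step L V) → L.Term V → Prop
  | nil (t : L.Term V) : Conversion R t [] t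
  | fwd {s t u : L.Term V} {π : RedexPattern L V} {c : List (Step L V)} :
      StepWith R s π t → Conversion R t c u → Conversion R s (⟨s, π, t, true⟩ :: c) u
  | bwd {s t u : L.Term V} {π : RedexPattern L V} {c : List (Step L V)} :
      StepWith R s π t → Conversion R s c u → Conversion R t (⟨s, π, t, false⟩ :: c) u

/-- `s →^= t`, as a conversion with at most one step, directed from `s` to `t`. -/
def FwdOpt (R : TRS L V) (s : L.Term V) (c : List (Step L V)) (t : L.Term V) : Prop :=
  Conversion R s c t ∧ c.length ≤ 1 ∧ ∀ a ∈ c, a.forward = true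

/-- `s ←^= t`, as a conversion with at most one step, directed from `t` to `s`. -/
def BwdOpt (R : TRS L V) (s : L.Term V) (c : List (Step L V)) (t : L.Term V) : Prop :=
  Conversion R s c t ∧ c.length ≤ 1 ∧ ∀ a ∈ c, a.forward = false

/-- The set of labels of a conversion. -/
def labels (lab : Step L V → Λ) (c : List (Step L V)) : Set Λ := {β | ∃ a ∈ c, lab a = β}

/-- The set of all `β` such that `α ≽ β` for some `α ∈ S`. -/
def below (rel : Λ → Λ → Prop) (S : Set Λ) : Set Λ := {β | ∃ α ∈ S, rel α β}

/-- The local peak `t ←^{π₁} s →^{π₂} u` of `R`. -/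
def LocalPeak (R : TRS L V) (t : L.Term V) (π₁ : RedexPattern L V) (s : L.Term V)
    (π₂ : RedexPattern L V) (u : L.Term V) : Prop :=
  StepWith R s π₁ t ∧ StepWith R s π₂ u

/-- A local peak whose steps take place at parallel positions. -/
def ParallelPeak (R : TRS L V) (t : L.Term V) (π₁ : RedexPattern L V) (s : L.Term V)
    (π₂ : RedexPattern L V) (u : L.Term V) : Prop :=
  LocalPeak R t π₁ s π₂ u ∧ ¬ π₁.pos <+: π₂.pos ∧ ¬ π₂.pos <+: π₁.pos

/-- A local peak whose left step takes place at or below a variable position of the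
left-hand side of the rule of the right step. -/
def VariablePeak (R : TRS L V) (t : L.Term V) (π₁ : RedexPattern L V) (s : L.Term V)
    (π₂ : RedexPattern L V) (u : L.Term V) : Prop :=
  LocalPeak R t π₁ s π₂ u ∧ ∃ q, π₁.pos = π₂.pos ++ q ∧ q ∉ FPos π₂.rule.lhs

/-- The local peak `t ←^{π₁} s →^{π₂} u` is extended locally decreasing for `ℓ`, `>` and `≥`: there
is a local diagram `t ↔^* t' →^= t'' ↔^* u'' ←^= u' ↔^* u` whose labels are as required. -/
def ExtLocallyDecreasing (R : TRS L V) (gt ge : Λ → Λ → Prop) (lab : Step L V → Λ)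
    (t : L.Term V) (π₁ : RedexPattern L V) (s : L.Term V) (π₂ : RedexPattern L V)
    (u : L.Term V) : Prop :=
  let α := lab ⟨s, π₁, t, false⟩
  let β := lab ⟨s, π₂, u, true⟩
  ∃ (t' t'' u'' u' : L.Term V) (c₁ c₂ c₃ c₄ c₅ : List (Step L V)),
    (Conversion R t c₁ t' ∧ labels lab c₁ ⊆ below gt {α}) ∧
    (FwdOpt R t' c₂ t'' ∧ labels lab c₂ ⊆ below ge {β}) ∧
    (Conversion R t'' c₃ u'' ∧ labels lab c₃ ⊆ below gt {α, β}) ∧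
    (BwdOpt R u'' c₄ u' ∧ labels lab c₄ ⊆ below ge {α}) ∧
    (Conversion R u' c₅ u ∧ labels lab c₅ ⊆ below gt {β})

/-- All parallel peaks of `R` are extended locally decreasing. -/
def ParallelPeaksDecreasing (R : TRS L V) (gt ge : Λ → Λ → Prop) (lab : Step L V → Λ) : Prop :=
  ∀ t π₁ s π₂ u, ParallelPeak R t π₁ s π₂ u → ExtLocallyDecreasing R gt ge lab t π₁ s π₂ u

/-- All variable peaks of `R` are extended locally decreasing. -/
def VariablePeaksDecreasing (R : TRS L V) (gt ge : Λ → Λ → Prop) (lab : Step L V → Λ) : Prop :=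
  ∀ t π₁ s π₂ u, VariablePeak R t π₁ s π₂ u → ExtLocallyDecreasing R gt ge lab t π₁ s π₂ u

/-- `ℓ` is a labeling that is compatible with `R`. -/
def Compatible (R : TRS L V) (gt ge : Λ → Λ → Prop) (lab : Step L V → Λ) : Prop :=
  IsLabeling R gt ge lab ∧ ParallelPeaksDecreasing R gt ge lab ∧
    VariablePeaksDecreasing R gt ge lab

end Labels

/-- The source labeling: a rewrite step `s →^π t` is labeled by its source `s`, whichever way it
is used. -/
def srcLab (a : Step L V) : L.Term V := a.source

/-- The strict order for the source labeling: the transitive closure of the rewrite relation of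
the duplicating rules relative to the non-duplicating ones. -/
def srcGt (R : TRS L V) : L.Term V → L.Term V → Prop :=
  Relation.TransGen (RelRew (dup R) (nondup R))

/-- The weak order for the source labeling: `→_R^*`. -/
def srcGe (R : TRS L V) : L.Term V → L.Term V → Prop := Relation.ReflTransGen (Rew R)

end TermRewriting

namespace TermRewriting

open FirstOrder.Language Relation

/-! ### Subterms, replacement and contexts -/

section Positions

variable {L : FirstOrder.Language.{u, v}} {V : Type w}

/-! Each step of `R` is duplicating or non-duplicating. The relative relation absorbs the latter on
both sides and contains the former, so `>` absorbs `→_R^*` on both sides; this is the compatibility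
of `>` with `≥`. Closure of rewriting under contexts and substitutions makes the source labeling a
labeling.

In a peak `t ← s → u` both labels are `s`. Parallel steps commute, and the closing steps start at
the reducts `t` and `u` of `s`, so `≥` suffices. In a variable peak with outer rule `l → r`,
left-linearity means that the inner step only changes `σ` at one variable `x`, giving `σ'`. Hence `t
= C[lσ'] → C[rσ']`, while `u = C[rσ]` reaches `C[rσ']` with one step per occurrence of `x` in `r`.
If the rule does not duplicate, there is at most one such step and `≥` suffices again. If it
duplicates, then `s > u`, so `s` is above every source on the way from `u`, and any number of steps
is allowed. -/

theorem Context.subtermAt_fill (C : Context L V) (t : L.Term V) (p : Position) :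
    subtermAt (C.fill t) (C.holePos ++ p) = subtermAt t p := by
  induction C with
  | hole => rfl
  | arg f i ts C ih => simp [Context.fill, Context.holePos, subtermAt, ih]

theorem Context.replaceAt_fill (C : Context L V) (t w : L.Term V) (p : Position) :
    replaceAt (C.fill t) (C.holePos ++ p) w = C.fill (replaceAt t p w) := by
  induction C with
  | hole => rfl
  | arg f i ts C ih =>
    simp only [Context.fill, Context.holePos, replaceAt, List.cons_append, Nat.natPred_succPNat,
      Fin.val_inj]
    congr 1
    funext j
    by_cases h : j = i <;> simp [h, ih]

/-- Every subterm sits in a context. -/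
theorem exists_context_of_subtermAt (s : L.Term V) (p : Position) (t : L.Term V)
    (h : subtermAt s p = some t) : ∃ C : Context L V, C.holePos = p ∧ C.fill t = s := by
  induction p generalizing s with
  | nil =>
    cases s <;> exact ⟨.hole, rfl, by simpa [subtermAt, Context.fill, eq_comm] using h⟩
  | cons i p ih =>
    cases s with
    | var y => simp [subtermAt] at h
    | @func n f ts =>
      simp only [subtermAt] at h
      split_ifs at h with hi
      obtain ⟨C, hC, hf⟩ := ih _ h
      refine ⟨.arg f ⟨i.natPred, hi⟩ ts C, by simp [Context.holePos, hC], ?_⟩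
      simp only [Context.fill]
      congr 1
      funext j
      split_ifs with hj
      · rw [hf, hj]
      · rfl

theorem subtermAt_subst (σ : Subst L V) (s : L.Term V) (p : Position) (t : L.Term V)
    (h : subtermAt s p = some t) : subtermAt (s.subst σ) p = some (t.subst σ) := by
  induction p generalizing s with
  | nil => cases s <;> cases h <;> simp [subtermAt]
  | cons i p ih =>
    cases s with
    | var y => simp [subtermAt] at h
    | @func n f ts =>
      simp only [subtermAt] at h
      split_ifs at h with hi
      simp [subtermAt, Term.subst, hi, ih _ h]

theorem replaceAt_subst (σ : Subst L V) (s : L.Term V) (p : Position) (t w : L.Term V)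
    (h : subtermAt s p = some t) :
    (replaceAt s p w).subst σ = replaceAt (s.subst σ) p (w.subst σ) := by
  induction p generalizing s with
  | nil => simp [replaceAt]
  | cons i p ih =>
    cases s with
    | var y => simp [subtermAt] at h
    | @func n f ts =>
      simp only [subtermAt] at h
      split_ifs at h with hi
      simp only [replaceAt, Term.subst]
      congr 1
      funext j
      split_ifs with hj
      · obtain rfl : j = ⟨i.natPred, hi⟩ := Fin.ext hj
        exact ih _ h
      · rfl

theorem subtermAt_replaceAt_of_parallel (s w : L.Term V) (p q : Position)
    (hpq : ¬ p <+: q) (hqp : ¬ q <+: p) :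
    subtermAt (replaceAt s p w) q = subtermAt s q := by
  induction p generalizing s q with
  | nil => simp at hpq
  | cons i p ih =>
    cases q with
    | nil => simp at hqp
    | cons k q =>
      cases s with
      | var y => simp [replaceAt]
      | @func n f ts =>
        simp only [replaceAt, subtermAt]
        split_ifs with hk hki
        · obtain rfl : k = i := PNat.natPred_injective hki
          rw [List.prefix_cons_inj] at hpq hqp
          exact ih _ _ hpq hqp
        · rfl
        · rfl

theorem replaceAt_comm_of_parallel (s a b : L.Term V) (p q : Position)
    (hpq : ¬ p <+: q) (hqp : ¬ q <+: p) :
    replaceAt (replaceAt s p a) q b = replaceAt (replaceAt s q b) p a := by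
  induction p generalizing s q with
  | nil => simp at hpq
  | cons i p ih =>
    cases q with
    | nil => simp at hqp
    | cons k q =>
      cases s with
      | var y => simp [replaceAt]
      | @func n f ts =>
        simp only [replaceAt]
        congr 1
        funext j
        split_ifs with hk hi hi
        · obtain rfl : k = i := PNat.natPred_injective (hk.symm.trans hi)
          rw [List.prefix_cons_inj] at hpq hqp
          exact ih _ _ hpq hqp
        all_goals rfl

end Positions

/-! ### Variable occurrences and linearity -/

section Occurrences

variable {L : FirstOrder.Language.{u, v}} {V : Type w}

open Classical in
theorem subst_update_of_occ_eq_zero (σ : Subst L V) (x : V) (a t : L.Term V)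
    (h : occ x t = 0) : t.subst (Function.update σ x a) = t.subst σ := by
  induction t with
  | var z =>
    have hz : z ≠ x := by simpa [occ] using h
    simp [Term.subst, hz]
  | func f ts ih =>
    simp only [occ, Finset.sum_eq_zero_iff, Finset.mem_univ, true_imp_iff] at h
    simp only [Term.subst]
    congr 1
    funext j
    exact ih j (h j)

theorem occ_eq_zero_of_sum_le_one {n : ℕ} {ts : Fin n → L.Term V} {x : V} {i j : Fin n}
    (hsum : ∑ k, occ x (ts k) ≤ 1) (hi : 0 < occ x (ts i)) (hj : j ≠ i) :
    occ x (ts j) = 0 := by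
  have h := Finset.add_le_sum (f := fun k => occ x (ts k)) (s := Finset.univ)
    (fun _ _ => Nat.zero_le _) (Finset.mem_univ i) (Finset.mem_univ j) hj.symm
  omega

open Classical in
/-- Replacing a subterm of `lσ` at or below a variable position of a linear term `l` amounts to
changing `σ` at that variable. -/
theorem exists_replaceAt_subst_eq_subst_update (σ : Subst L V) (l : L.Term V) (q : Position)
    (b : L.Term V) (hlin : ∀ y, occ y l ≤ 1) (hq : q ∉ FPos l)
    (hb : subtermAt (l.subst σ) q = some b) :
    ∃ x q', 0 < occ x l ∧ subtermAt (σ x) q' = some b ∧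
      ∀ a, replaceAt (l.subst σ) q a =
        l.subst (Function.update σ x (replaceAt (σ x) q' a)) := by
  induction l generalizing q with
  | var z => exact ⟨z, q, by simp [occ], hb, fun a => by simp [Term.subst]⟩
  | @func n f ts ih =>
    cases q with
    -- The root of a compound term is a function position, so `q` must descend into an argument.
    | nil => exact absurd ⟨n, f, ts, by simp [subtermAt]⟩ hq
    | cons i q =>
      simp only [Term.subst, subtermAt] at hb
      split_ifs at hb with hi
      have hle : ∀ y, occ y (ts ⟨i.natPred, hi⟩) ≤ 1 := fun y =>
        (Finset.single_le_sum (f := fun k => occ y (ts k)) (fun _ _ => Nat.zero_le _)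
          (Finset.mem_univ _)).trans (hlin y)
      have hq' : q ∉ FPos (ts ⟨i.natPred, hi⟩) := fun ⟨m, g, us, h⟩ =>
        hq ⟨m, g, us, by simp [subtermAt, hi, h]⟩
      obtain ⟨x, q', hx, hxb, hrep⟩ := ih _ q hle hq' hb
      refine ⟨x, q', hx.trans_le (Finset.single_le_sum (f := fun k => occ x (ts k))
        (fun _ _ => Nat.zero_le _) (Finset.mem_univ _)), hxb, fun a => ?_⟩
      simp only [Term.subst, replaceAt]
      congr 1
      funext j
      split_ifs with hj
      · obtain rfl : j = ⟨i.natPred, hi⟩ := Fin.ext hj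
        exact hrep a
      -- By linearity `x` occurs in the argument containing the redex only, so the update leaves the
      -- other arguments alone.
      · exact (subst_update_of_occ_eq_zero _ _ _ _
          (occ_eq_zero_of_sum_le_one (hlin x) hx fun h => hj (by rw [h]))).symm

end Occurrences

/-! ### Closure of rewriting, and the orders on labels -/

section Rewriting

variable {L : FirstOrder.Language.{u, v}} {V : Type w} {R S : TRS L V}

theorem StepWith.lift {s t : L.Term V} {π : RedexPattern L V} (h : StepWith R s π t)
    (C : Context L V) (σ : Subst L V) :
    StepWith R (C.fill (s.subst σ)) (π.lift C σ) (C.fill (t.subst σ)) := by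
  have hcomp : ∀ t : L.Term V, t.subst (fun y => (π.sub y).subst σ) = (t.subst π.sub).subst σ := by
    intro t
    induction t with
    | var z => rfl
    | func f ts ih => simp [Term.subst, ih]
  obtain ⟨hR, hs, rfl⟩ := h
  refine ⟨hR, ?_, ?_⟩
  · simp only [RedexPattern.lift, Context.subtermAt_fill, hcomp]
    exact subtermAt_subst _ _ _ _ hs
  · simp only [RedexPattern.lift, Context.replaceAt_fill, hcomp]
    rw [replaceAt_subst σ _ _ _ _ hs]

theorem Rew.lift {s t : L.Term V} (h : Rew R s t) (C : Context L V) (σ : Subst L V) :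
    Rew R (C.fill (s.subst σ)) (C.fill (t.subst σ)) :=
  let ⟨_, hπ⟩ := h
  ⟨_, hπ.lift C σ⟩

theorem Rew.fill {s t : L.Term V} (h : Rew R s t) (C : Context L V) :
    Rew R (C.fill s) (C.fill t) := by
  have hid : ∀ t : L.Term V, t.subst Term.var = t := by
    intro t
    induction t with
    | var z => rfl
    | func f ts ih => simp [Term.subst, ih]
  simpa [hid] using h.lift C Term.var

theorem RelRew.lift {s t : L.Term V} (h : RelRew R S s t) (C : Context L V) (σ : Subst L V) :
    RelRew R S (C.fill (s.subst σ)) (C.fill (t.subst σ)) := by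
  obtain ⟨a, hsa, b, hab, hbt⟩ := h
  exact ⟨_, hsa.lift (fun s => C.fill (s.subst σ)) fun _ _ h => h.lift C σ, _, hab.lift C σ,
    hbt.lift (fun s => C.fill (s.subst σ)) fun _ _ h => h.lift C σ⟩

theorem Rew.dup_or_nondup {s t : L.Term V} (h : Rew R s t) :
    Rew (dup R) s t ∨ Rew (nondup R) s t := by
  obtain ⟨π, hR, h⟩ := h
  by_cases hd : π.rule.Duplicating
  · exact .inl ⟨π, ⟨hR, hd⟩, h⟩
  · exact .inr ⟨π, ⟨hR, hd⟩, h⟩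

theorem RelRew.of_rew {s t : L.Term V} (h : Rew R s t) : RelRew R S s t :=
  ⟨s, .refl, t, h, .refl⟩

/-- A duplicating step is itself a relative step; a non-duplicating one extends the `nondup R`
prefix of the first relative step of the chain. -/
theorem srcGt.of_rew_left {s t w : L.Term V} (h : Rew R s t) (htw : srcGt R t w) :
    srcGt R s w := by
  rcases h.dup_or_nondup with h | h
  · exact htw.head (.of_rew h)
  · rcases TransGen.head'_iff.1 htw with ⟨c, ⟨a, hta, hac⟩, hcw⟩
    exact TransGen.head' ⟨a, hta.head h, hac⟩ hcw

theorem srcGt.of_rew_right {s t w : L.Term V} (hst : srcGt R s t) (h : Rew R t w) :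
    srcGt R s w := by
  rcases h.dup_or_nondup with h | h
  · exact hst.tail (.of_rew h)
  · rcases TransGen.tail'_iff.1 hst with ⟨c, hsc, a, hca, b, hab, hbt⟩
    exact TransGen.tail' hsc ⟨a, hca, b, hab, hbt.tail h⟩

theorem srcGt.of_srcGe_left {s t w : L.Term V} (h : srcGe R s t) (htw : srcGt R t w) :
    srcGt R s w := by
  induction h using ReflTransGen.head_induction_on with
  | refl => exact htw
  | head h _ ih => exact ih.of_rew_left h

theorem srcGt.of_srcGe_right {s t w : L.Term V} (hst : srcGt R s t) (h : srcGe R t w) :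
    srcGt R s w := by
  induction h with
  | refl => exact hst
  | tail _ h ih => exact ih.of_rew_right h

theorem isOrderPair_src (hterm : TerminatesRelativeTo (dup R) (nondup R)) :
    IsOrderPair (srcGt R) (srcGe R) where
  gt_terminating := by
    have h : (fun a b => srcGt R b a) =
        TransGen (fun a b => RelRew (dup R) (nondup R) b a) := by
      funext a b
      exact propext transGen_swap.symm
    unfold Terminating
    rw [h]
    exact WellFounded.transGen hterm
  gt_trans _ _ _ := TransGen.trans
  ge_refl _ := .refl
  ge_trans _ _ _ := ReflTransGen.trans
  compat _ _ _ _ hab hbc hcd := (hbc.of_srcGe_left hab).of_srcGe_right hcd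

theorem isLabeling_srcLab : IsLabeling R (srcGt R) (srcGe R) srcLab where
  gt_lift _ _ _ _ h C σ :=
    TransGen.lift (fun s : L.Term V => C.fill (s.subst σ)) (fun _ _ h => RelRew.lift h C σ) _ _ h
  ge_lift _ _ _ _ h C σ :=
    ReflTransGen.lift (fun s : L.Term V => C.fill (s.subst σ)) (fun _ _ h => Rew.lift h C σ) _ _ h
  symm _ _ _ _ := rfl

/-! ### Rewriting inside a substitution -/

theorem Context.fill_arg_hole {n : ℕ} (f : L.Functions n) (i : Fin n) (ts : Fin n → L.Term V)
    (a : L.Term V) : (Context.arg f i ts .hole).fill a = .func f (Function.update ts i a) := by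
  simp only [Context.fill]
  congr 1
  funext j
  rw [Function.update_apply]

theorem reflTransGen_rew_func {n : ℕ} (f : L.Functions n) {ts us : Fin n → L.Term V}
    (h : ∀ j, ReflTransGen (Rew R) (ts j) (us j)) :
    ReflTransGen (Rew R) (.func f ts) (.func f us) := by
  -- The arguments are rewritten one at a time; `s` collects those already done.
  suffices H : ∀ s : Finset (Fin n),
      ReflTransGen (Rew R) (.func f ts) (.func f (s.piecewise us ts)) by
    simpa using H Finset.univ
  intro s
  induction s using Finset.induction_on with
  | empty => simpa using ReflTransGen.refl
  | insert i s hi ih =>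
    refine ih.trans ?_
    have h' : ReflTransGen (Rew R)
        ((Context.arg f i (s.piecewise us ts) .hole).fill (ts i))
        ((Context.arg f i (s.piecewise us ts) .hole).fill (us i)) :=
      (h i).lift _ fun _ _ h => h.fill _
    rwa [Context.fill_arg_hole, Context.fill_arg_hole, ← Finset.piecewise_insert,
      Function.update_eq_self_iff.2 (Finset.piecewise_eq_of_notMem s us ts hi).symm] at h'

open Classical in
theorem reflTransGen_rew_subst_update {σ : Subst L V} {x : V} {a : L.Term V}
    (h : Rew R (σ x) a) (r : L.Term V) :
    ReflTransGen (Rew R) (r.subst σ) (r.subst (Function.update σ x a)) := by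
  induction r with
  | var z =>
    by_cases hz : z = x
    · subst hz
      simpa [Term.subst] using ReflTransGen.single h
    · simpa [Term.subst, hz] using ReflTransGen.refl
  | func f ts ih => exact reflTransGen_rew_func f ih

open Classical in
-- At most one copy of `σ x` has to be rewritten; this is what keeps the non-duplicating case within
-- a single closing step.
theorem reflGen_rew_subst_update {σ : Subst L V} {x : V} {a : L.Term V}
    (h : Rew R (σ x) a) (r : L.Term V) (hr : occ x r ≤ 1) :
    ReflGen (Rew R) (r.subst σ) (r.subst (Function.update σ x a)) := by
  induction r with
  | var z =>
    by_cases hz : z = x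
    · subst hz
      simpa [Term.subst] using ReflGen.single h
    · simpa [Term.subst, hz] using ReflGen.refl
  | @func n f ts ih =>
    by_cases h0 : occ x (.func f ts) = 0
    · rw [subst_update_of_occ_eq_zero _ _ _ _ h0]
    · obtain ⟨i, -, hi⟩ := Finset.exists_ne_zero_of_sum_ne_zero h0
      have hle := (Finset.single_le_sum (f := fun k => occ x (ts k))
        (fun _ _ => Nat.zero_le _) (Finset.mem_univ i)).trans hr
      -- Only argument `i` contains `x`, so both instances are fillings of one common context.
      have key : Term.subst (.func f ts) (Function.update σ x a) =
          (Context.arg f i (fun j => (ts j).subst σ) .hole).fill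
            ((ts i).subst (Function.update σ x a)) := by
        simp only [Term.subst, Context.fill]
        congr 1
        funext j
        split_ifs with hj
        · rw [hj]
        · exact subst_update_of_occ_eq_zero _ _ _ _
            (occ_eq_zero_of_sum_le_one hr (Nat.pos_of_ne_zero hi) hj)
      have key' : Term.subst (.func f ts) σ =
          (Context.arg f i (fun j => (ts j).subst σ) .hole).fill ((ts i).subst σ) := by
        rw [Context.fill_arg_hole, Function.update_eq_self_iff.2 rfl, Term.subst]
      rw [key, key']
      rcases reflGen_iff _ _ _ |>.1 (ih i hle) with he | hs
      · rw [he]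
      · exact .single (hs.fill _)

end Rewriting

/-! ### Closing the peaks -/

section Peaks

variable {L : FirstOrder.Language.{u, v}} {V : Type w} {R : TRS L V}

/-- The rewrite sequence is read backwards, as the right-hand side of a diagram requires; its
sources remain reducts of `s`. -/
theorem exists_conversion_of_reflTransGen {s t : L.Term V} (h : ReflTransGen (Rew R) s t) :
    ∃ c, Conversion R t c s ∧ ∀ a ∈ c, ReflTransGen (Rew R) s a.source := by
  induction h with
  | refl => exact ⟨[], .nil _, by simp⟩
  | tail hsb hbt ih =>
    obtain ⟨c, hc, hlab⟩ := ih
    obtain ⟨π, hπ⟩ := hbt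
    exact ⟨_, .bwd hπ hc, by simpa using ⟨hsb, hlab⟩⟩

theorem exists_bwdOpt_of_reflGen {s t : L.Term V} (h : ReflGen (Rew R) s t) :
    ∃ c, BwdOpt R t c s ∧ ∀ a ∈ c, a.source = s := by
  cases h with
  | refl => exact ⟨[], ⟨.nil _, by simp, by simp⟩, by simp⟩
  | single h =>
    obtain ⟨π, hπ⟩ := h
    exact ⟨_, ⟨.bwd hπ (.nil _), by simp, by simp⟩, by simp⟩

theorem exists_fwdOpt_of_rew {s t : L.Term V} (h : Rew R s t) :
    ∃ c, FwdOpt R s c t ∧ ∀ a ∈ c, a.source = s := by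
  obtain ⟨π, hπ⟩ := h
  exact ⟨_, ⟨.fwd hπ (.nil _), by simp, by simp⟩, by simp⟩

theorem labels_srcLab_subset {rel : L.Term V → L.Term V → Prop} {c : List (Step L V)}
    {s : L.Term V} (h : ∀ a ∈ c, rel s a.source) : labels srcLab c ⊆ below rel {s} := by
  rintro _ ⟨a, ha, rfl⟩
  exact ⟨s, rfl, h a ha⟩

theorem labels_nil_subset {Λ : Type x} (lab : Step L V → Λ) (S : Set Λ) :
    labels lab [] ⊆ S := by
  rintro _ ⟨a, ha, -⟩
  simp at ha

theorem extLocallyDecreasing_of_reflGen {s t u v : L.Term V} {π₁ π₂ : RedexPattern L V}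
    (hpeak : LocalPeak R t π₁ s π₂ u) (ht : Rew R t v) (hu : ReflGen (Rew R) u v) :
    ExtLocallyDecreasing R (srcGt R) (srcGe R) srcLab t π₁ s π₂ u := by
  obtain ⟨c₂, hc₂, h₂⟩ := exists_fwdOpt_of_rew ht
  obtain ⟨c₄, hc₄, h₄⟩ := exists_bwdOpt_of_reflGen hu
  refine ⟨t, v, v, u, [], c₂, [], c₄, [], ⟨.nil _, labels_nil_subset _ _⟩,
    ⟨hc₂, labels_srcLab_subset fun a ha => ?_⟩, ⟨.nil _, labels_nil_subset _ _⟩,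
    ⟨hc₄, labels_srcLab_subset fun a ha => ?_⟩, ⟨.nil _, labels_nil_subset _ _⟩⟩
  · rw [h₂ a ha]
    exact .single ⟨_, hpeak.1⟩
  · rw [h₄ a ha]
    exact .single ⟨_, hpeak.2⟩

theorem extLocallyDecreasing_of_srcGt {s t u v : L.Term V} {π₁ π₂ : RedexPattern L V}
    (hst : StepWith R s π₁ t) (hsu : srcGt R s u) (ht : Rew R t v)
    (hu : ReflTransGen (Rew R) u v) :
    ExtLocallyDecreasing R (srcGt R) (srcGe R) srcLab t π₁ s π₂ u := by
  obtain ⟨c₂, hc₂, h₂⟩ := exists_fwdOpt_of_rew ht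
  obtain ⟨c₅, hc₅, h₅⟩ := exists_conversion_of_reflTransGen hu
  -- All of `u →* v` goes into the fifth part, the one of unbounded length below `β`.
  refine ⟨t, v, v, v, [], c₂, [], [], c₅, ⟨.nil _, labels_nil_subset _ _⟩,
    ⟨hc₂, labels_srcLab_subset fun a ha => ?_⟩, ⟨.nil _, labels_nil_subset _ _⟩,
    ⟨⟨.nil _, by simp, by simp⟩, labels_nil_subset _ _⟩,
    ⟨hc₅, labels_srcLab_subset fun a ha => hsu.of_srcGe_right (h₅ a ha)⟩⟩
  rw [h₂ a ha]
  exact .single ⟨_, hst⟩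

theorem parallelPeaksDecreasing_srcLab :
    ParallelPeaksDecreasing R (srcGt R) (srcGe R) srcLab := by
  rintro t π₁ s π₂ u ⟨hpeak, h₁₂, h₂₁⟩
  have ⟨⟨hR₁, hs₁, ht⟩, hR₂, hs₂, hu⟩ := hpeak
  refine extLocallyDecreasing_of_reflGen hpeak
    ⟨π₂, hR₂, by rw [ht, subtermAt_replaceAt_of_parallel _ _ _ _ h₁₂ h₂₁, hs₂], rfl⟩
    (.single ⟨π₁, hR₁, by rw [hu, subtermAt_replaceAt_of_parallel _ _ _ _ h₂₁ h₁₂, hs₁], ?_⟩)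
  rw [ht, hu, replaceAt_comm_of_parallel _ _ _ _ _ h₁₂ h₂₁]

open Classical in
theorem variablePeaksDecreasing_srcLab (hlin : LeftLinear R) :
    VariablePeaksDecreasing R (srcGt R) (srcGe R) srcLab := by
  rintro t π₁ s ⟨p, ρ, σ⟩ u ⟨hpeak, q, hpos, hq⟩
  have ⟨⟨hR₁, hs₁, ht⟩, hR₂, hs₂, hu⟩ := hpeak
  simp only at hR₂ hs₂ hu hpos hq
  obtain ⟨C, rfl, rfl⟩ := exists_context_of_subtermAt _ _ _ hs₂
  have hfill : ∀ a b : L.Term V, replaceAt (C.fill a) C.holePos b = C.fill b := fun a b => by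
    simpa [replaceAt] using C.replaceAt_fill a b []
  rw [hpos, Context.subtermAt_fill] at hs₁
  rw [hpos, Context.replaceAt_fill] at ht
  rw [hfill] at hu
  obtain ⟨x, q', hx, hb, hrep⟩ :=
    exists_replaceAt_subst_eq_subst_update σ ρ.lhs q _ (hlin ρ hR₂) hq hs₁
  rw [hrep] at ht
  have hstep : Rew R (σ x) (replaceAt (σ x) q' (π₁.rule.rhs.subst π₁.sub)) :=
    ⟨⟨q', π₁.rule, π₁.sub⟩, hR₁, hb, rfl⟩
  set σ' := Function.update σ x (replaceAt (σ x) q' (π₁.rule.rhs.subst π₁.sub)) with hσ'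
  -- The inner step left an instance of the left-hand side, so the outer rule still applies at the
  -- same position.
  have htv : Rew R t (C.fill (ρ.rhs.subst σ')) := by
    refine ⟨⟨C.holePos, ρ, σ'⟩, hR₂, ?_, ?_⟩
    · rw [ht]
      simpa [subtermAt] using C.subtermAt_fill (ρ.lhs.subst σ') []
    · rw [ht, hfill]
  by_cases hd : ρ.Duplicating
  · refine extLocallyDecreasing_of_srcGt hpeak.1
      (.single (.of_rew ⟨⟨C.holePos, ρ, σ⟩, ⟨hR₂, hd⟩, hpeak.2.2⟩)) htv ?_
    rw [hu]
    exact (reflTransGen_rew_subst_update hstep ρ.rhs).lift C.fill fun _ _ h => h.fill C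
  -- Non-duplication bounds the occurrences in the right-hand side by those in the linear left-hand
  -- side.
  · have hle : occ x ρ.rhs ≤ 1 :=
      (not_lt.1 fun h => hd ⟨x, h⟩).trans (hlin ρ hR₂ x)
    refine extLocallyDecreasing_of_reflGen hpeak htv ?_
    rw [hu]
    rcases reflGen_iff _ _ _ |>.1 (reflGen_rew_subst_update hstep ρ.rhs hle) with he | hs
    · rw [← hσ'] at he
      rw [he]
    · exact .single (hs.fill C)

end Peaks

end TermRewriting

theorem mainTheorem9 {L : FirstOrder.Language.{u, v}} {V : Type w}
    (R : TermRewriting.TRS L V) (hlin : TermRewriting.LeftLinear R)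
    (hterm : TermRewriting.TerminatesRelativeTo
      (TermRewriting.dup R) (TermRewriting.nondup R)) :
    TermRewriting.IsOrderPair (TermRewriting.srcGt R) (TermRewriting.srcGe R) ∧
    TermRewriting.IsLabeling R (TermRewriting.srcGt R) (TermRewriting.srcGe R)
      TermRewriting.srcLab ∧
    TermRewriting.ParallelPeaksDecreasing R (TermRewriting.srcGt R) (TermRewriting.srcGe R)
      TermRewriting.srcLab ∧
    TermRewriting.VariablePeaksDecreasing R (TermRewriting.srcGt R) (TermRewriting.srcGe R)
      TermRewriting.srcLab ∧
    TermRewriting.Compatible R (TermRewriting.srcGt R) (TermRewriting.srcGe R)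
      TermRewriting.srcLab := by
  have hpar := TermRewriting.parallelPeaksDecreasing_srcLab (R := R)
  have hvar := TermRewriting.variablePeaksDecreasing_srcLab hlin
  exact ⟨TermRewriting.isOrderPair_src hterm, TermRewriting.isLabeling_srcLab, hpar, hvar,
    TermRewriting.isLabeling_srcLab, hpar, hvar⟩
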